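/- Let $\mathbb{F}=\{0,1\}$ be the field with two elements, let $d$ be the Hamming distance on $\mathbb{F}^n$, let $B_t(\mathbf{x})=\{\mathbf{y}\in\mathbb{F}^n : d(\mathbf{x},\mathbf{y})\le t\}$ and $V(n,t)=\sum_{i=0}^{t}\binom{n}{i}$. A nonempty set $C\subseteq\mathbb{F}^n$ is an $e$-error-correcting code if any two distinct elements of $C$ are at distance at least $2e+1$. For integers $e\ge 0$ and $\ell\ge 1$ put $t=e+\ell$. For an $e$-error-correcting code $C$ and a set $Y\subseteq\mathbb{F}^n$ of output words let $$T(Y)=C\cap\bigcap_{\mathbf{y}\in Y}B_t(\mathbf{y}),$$ and let the list size of $C$ with $N$ channels be $\mathcal{L}=\max\{|T(Y)| : Y\subseteq\mathbb{F}^n,\ |Y|=N\}$ (with $\mathcal{L}=0$ if $N>2^n$). Let $N'(n,\ell,e,h)$ be the maximum of $|Y|$ over all $Y\subseteq\mathbb{F}^n$ such that $|T(Y)|\ge h$ for some $e$-error-correcting code $C\subseteq\mathbb{F}^n$. If $h$ is the smallest non-negative integer $h'$ with $N'(n,\ell,e,h')=N'(n,\ell,e,h)$, one writes $N_h=N'(n,\ell,e,h)$;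 otherwise $N_h$ is not defined. Finally, let $$n(e,\ell,b)=(\ell-1)^2\left(b-e+(e+1)\left(b-3e-2e^2+eb+\binom{b-2e-1}{2}\right)\right)+\ell-2.$$ Let $n,e,\ell,b$ be non-negative integers with $\ell\ge 3$, $b\ge\max\{3t,4e+4\}$ and $n\ge n(e,\ell,b)$. If $N\ge V(n,\ell-1)+(e+1)^{\ell+1}+1$, then every $e$-error-correcting code $C\subseteq\mathbb{F}^n$ has list size $\mathcal{L}\le\ell$ with $N$ channels. Moreover, $N_{\ell+1}$ is defined, and $$N_{\ell+1}=V(n,\ell-1)+(e+1)^{\ell+1}.$$ -/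

import Mathlib

/-- The binary Hamming space `𝔽ⁿ`; its Hamming distance is Mathlib's `hammingDist`. -/
abbrev BinaryWord (n : ℕ) : Type := Fin n → ZMod 2

/-- The Hamming ball `B_t(x)`. -/
def hammingBall {n : ℕ} (t : ℕ) (x : BinaryWord n) : Finset (BinaryWord n) :=
  Finset.univ.filter fun y => hammingDist x y ≤ t

/-- `V(n,t) = ∑_{i=0}^t C(n,i)`, the cardinality of a Hamming ball of radius `t` in `𝔽ⁿ`. -/
def ballVolume (n t : ℕ) : ℕ := ∑ i ∈ Finset.range (t + 1), n.choose i

/-- `C` is a code (a nonempty set of words) that corrects `e` errors: distinct codewords are at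
distance at least `2e + 1`. -/
def IsErrorCorrecting {n : ℕ} (e : ℕ) (C : Finset (BinaryWord n)) : Prop :=
  C.Nonempty ∧ ∀ c₁ ∈ C, ∀ c₂ ∈ C, c₁ ≠ c₂ → 2 * e + 1 ≤ hammingDist c₁ c₂

/-- `T(Y) = C ∩ ⋂_{y ∈ Y} B_t(y)`, the codewords compatible with the output words in `Y` when at
most `t` substitution errors occur in each channel. -/
def outputList {n : ℕ} (C : Finset (BinaryWord n)) (t : ℕ) (Y : Finset (BinaryWord n)) :
    Finset (BinaryWord n) :=
  C.filter fun c => ∀ y ∈ Y, c ∈ hammingBall t y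

/-- The list size `𝓛 = max {|T(Y)| : Y a set of N output words}` of the code `C`. -/
def listSize {n : ℕ} (C : Finset (BinaryWord n)) (t N : ℕ) : ℕ :=
  (Finset.univ.powersetCard N).sup fun Y => (outputList C t Y).card

/-- The quantity
`n(e,ℓ,b) = (ℓ-1)² (b - e + (e+1) (b - 3e - 2e² + eb + C(b-2e-1, 2))) + ℓ - 2`, as an integer. The
subtraction `b - 2e - 1` in the binomial coefficient is one of natural numbers, which is harmless
for `b ≥ 4e + 4`. -/
def lengthBound (e l b : ℕ) : ℤ :=
  ((l : ℤ) - 1) ^ 2 *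
      ((b : ℤ) - e + ((e : ℤ) + 1) *
        ((b : ℤ) - 3 * e - 2 * (e : ℤ) ^ 2 + (e : ℤ) * b + ((b - 2 * e - 1).choose 2 : ℕ)))
    + l - 2

/-- `N = N'(n,ℓ,e,h)`: with `t = e + ℓ`, the number `N` is the maximum size of a set `Y` of output
words with `|T(Y)| ≥ h` for some `e`-error-correcting code in `𝔽ⁿ`. -/
def IsMaxChannels (n l e h N : ℕ) : Prop :=
  IsGreatest {M : ℕ | ∃ C Y : Finset (BinaryWord n),
    IsErrorCorrecting e C ∧ Y.card = M ∧ h ≤ (outputList C (e + l) Y).card} N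

/-- `N = N(n,ℓ,e,h) = N_h`: the number `N` equals `N'(n,ℓ,e,h)`, and `h` is the smallest integer for
which this value is attained. -/
def IsChannelNumber (n l e h N : ℕ) : Prop :=
  IsMaxChannels n l e h N ∧ ∀ h' < h, ¬ IsMaxChannels n l e h' N

/-! ### Counting sets by their intersections with disjoint blocks -/

section SetSystems

open Finset
open scoped symmDiff

variable {α : Type*} [DecidableEq α]

/-! Words are identified with their supports, so distance is the size of a symmetric difference. Put
`L = l - 1` and let `T` be a list of at least `L + 2` compatible codewords.

Upper bound (`card_le_of_separated`): translate so that the median of three codewords becomes the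
empty set; the three become disjoint sets, any two of total size at least `2e + 1`. If one of them
has size at least `e + 2`, outputs of weight at least `L` must meet these sets so often that there
are at most `n.choose L` of them (`card_heavy_le`). Together with the words of weight below `L` this
gives at most `V(n, L)` outputs (`card_le_of_far`). The same bound holds if the three are near the
median but some fourth codeword is not (`card_le_of_near_and_far`). In the remaining case `L + 2`
codewords are disjoint sets of size `e` or `e + 1`. Outputs of weight above `L` are then determined
by at most `e + 1` choices per codeword, whence the term `(e + 1) ^ (L + 2)`
(`card_le_of_centered`).

Sharpness (`exists_large_output_families`): `l + 1` disjoint blocks of size `e + 1` attain the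
bound. Dropping one block admits one more output, so no smaller list size has the same maximum. -/

theorem card_symmDiff_add_two_mul_card_inter (s t : Finset α) :
    (s ∆ t).card + 2 * (s ∩ t).card = s.card + t.card := by
  have h1 : (s ∆ t).card = (s \ t).card + (t \ s).card := by
    rw [symmDiff_def, sup_eq_union, card_union_of_disjoint disjoint_sdiff_sdiff]
  have h2 := card_sdiff_add_card_inter s t
  have h3 := card_sdiff_add_card_inter t s
  rw [inter_comm] at h3
  omega

theorem symmDiff_symmDiff_left_cancel (m s t : Finset α) : (m ∆ s) ∆ (m ∆ t) = s ∆ t := by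
  rw [symmDiff_symmDiff_symmDiff_comm, symmDiff_self, bot_symmDiff]

variable [Fintype α]

/-- The number of `r`-sets meeting three disjoint sets in prescribed numbers of points. -/
theorem card_le_choose_mul_choose {A B C : Finset α} (hAB : Disjoint A B) (hAC : Disjoint A C)
    (hBC : Disjoint B C) (r i j k : ℕ) (W : Finset (Finset α))
    (hW : ∀ w ∈ W, w.card = r ∧ i ≤ (w ∩ A).card ∧ j ≤ (w ∩ B).card ∧ k ≤ (w ∩ C).card) :
    W.card ≤ A.card.choose i * (B.card.choose j * (C.card.choose k *
      (Fintype.card α).choose (r - (i + j + k)))) := by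
  have hsub : W ⊆ (powersetCard i A ×ˢ (powersetCard j B ×ˢ (powersetCard k C ×ˢ
      powersetCard (r - (i + j + k)) (univ : Finset α)))).image
        (fun p => p.1 ∪ p.2.1 ∪ p.2.2.1 ∪ p.2.2.2) := by
    intro w hw
    obtain ⟨hr, hi, hj, hk⟩ := hW w hw
    obtain ⟨I, hI, hIc⟩ := exists_subset_card_eq hi
    obtain ⟨J, hJ, hJc⟩ := exists_subset_card_eq hj
    obtain ⟨M, hM, hMc⟩ := exists_subset_card_eq hk
    have hIA := hI.trans inter_subset_right
    have hJB := hJ.trans inter_subset_right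
    have hMC := hM.trans inter_subset_right
    have hIw := hI.trans inter_subset_left
    have hJw := hJ.trans inter_subset_left
    have hMw := hM.trans inter_subset_left
    have hu : I ∪ J ∪ M ⊆ w := union_subset (union_subset hIw hJw) hMw
    have hc : (I ∪ J ∪ M).card = i + j + k := by
      rw [card_union_of_disjoint, card_union_of_disjoint (hAB.mono hIA hJB), hIc, hJc, hMc]
      exact disjoint_union_left.2 ⟨hAC.mono hIA hMC, hBC.mono hJB hMC⟩
    refine mem_image.2 ⟨(I, J, M, w \ (I ∪ J ∪ M)), ?_, ?_⟩
    · simp only [mem_product, mem_powersetCard, subset_univ, true_and]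
      refine ⟨⟨hIA, hIc⟩, ⟨hJB, hJc⟩, ⟨hMC, hMc⟩, ?_⟩
      rw [card_sdiff_of_subset hu, hr, hc]
    · exact union_sdiff_of_subset hu
  refine (card_le_card hsub).trans (card_image_le.trans ?_)
  simp [card_product, card_powersetCard]

/-- The terms 0, 1, 2 use three quarters of `C`, and the later ones, paired as `2m + 3, 2m + 4`,
form a geometric tail of total at most `C / 4`. The induction carries the unused remainder `C / (4 *
2 ^ m)`. -/
theorem sum_range_le_of_decay (C : ℕ) (f : ℕ → ℕ) (h0 : ∀ s ≤ 2, 4 * f s ≤ C)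
    (h1 : ∀ s, 3 ≤ s → 4 * 2 ^ ((s + 1) / 2) * f s ≤ C) (m : ℕ) :
    ∑ s ∈ range m, f s ≤ C := by
  have key : ∀ m, 4 * 2 ^ m * ∑ s ∈ range (2 * m + 3), f s + C ≤ 4 * 2 ^ m * C := by
    intro m
    induction m with
    | zero =>
      have := h0 0 (by norm_num)
      have := h0 1 (by norm_num)
      have := h0 2 (by norm_num)
      simp [sum_range_succ]
      omega
    | succ m ih =>
      have e1 : 2 * (m + 1) + 3 = 2 * m + 3 + 1 + 1 := by ring
      rw [e1, sum_range_succ, sum_range_succ]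
      have h3 := h1 (2 * m + 3) (by omega)
      have h4 := h1 (2 * m + 3 + 1) (by omega)
      rw [show (2 * m + 3 + 1) / 2 = m + 2 by omega, pow_add] at h3
      rw [show (2 * m + 3 + 1 + 1) / 2 = m + 2 by omega, pow_add] at h4
      rw [pow_succ]
      nlinarith
  have hk := key m
  have hle : ∑ s ∈ range m, f s ≤ ∑ s ∈ range (2 * m + 3), f s :=
    sum_le_sum_of_subset (range_subset_range.2 (by omega))
  have hpos : 0 < 4 * 2 ^ m := by positivity
  exact hle.trans (Nat.le_of_mul_le_mul_left (by omega) hpos)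

/-- Below level `L` consecutive binomial coefficients have ratio `(n - i) / (i + 1)`, at least `L *
K` for such `n`; each lost degree of freedom gains this factor. -/
theorem choose_sub_mul_pow_le {n L K : ℕ} (hn : L * L * K + L ≤ n + 1) (k : ℕ) (hk : k ≤ L) :
    n.choose (L - k) * (L * K) ^ k ≤ n.choose L := by
  induction k with
  | zero => simp
  | succ k ih =>
    refine le_trans ?_ (ih (by omega))
    obtain ⟨i, hi⟩ : ∃ i, L = i + (k + 1) := ⟨L - (k + 1), by omega⟩
    rw [show L - (k + 1) = i by omega, show L - k = i + 1 by omega, pow_succ]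
    have h1 := Nat.choose_succ_right_eq n i
    have h2 : (i + 1) * (L * K) ≤ n - i := by
      calc (i + 1) * (L * K) ≤ L * (L * K) := Nat.mul_le_mul_right _ (by omega)
        _ = L * L * K := by ring
        _ ≤ n - i := by omega
    have h3 : n.choose i * (L * K) ≤ n.choose (i + 1) := by
      refine Nat.le_of_mul_le_mul_left ?_ i.succ_pos
      calc (i + 1) * (n.choose i * (L * K)) = n.choose i * ((i + 1) * (L * K)) := by ring
        _ ≤ n.choose i * (n - i) := Nat.mul_le_mul_left _ h2
        _ = (i + 1) * n.choose (i + 1) := by rw [← h1]; ring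
    calc n.choose i * ((L * K) ^ k * (L * K)) = n.choose i * (L * K) * (L * K) ^ k := by ring
      _ ≤ _ := Nat.mul_le_mul_right _ h3

theorem choose_le_choose_of_le {n L K i j : ℕ} (hn : L * L * K + L ≤ n + 1) (hij : i ≤ j)
    (hj : j ≤ L) (hK : 1 ≤ K) : n.choose i ≤ n.choose j := by
  have hK' : j * j * 1 ≤ L * L * K := by gcongr
  have h := choose_sub_mul_pow_le (n := n) (L := j) (K := 1) (by omega) (j - i) (by omega)
  rw [show j - (j - i) = i by omega] at h
  rcases Nat.eq_zero_or_pos j with rfl | hpos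
  · simp_all
  · refine le_trans (Nat.le_mul_of_pos_right _ ?_) h
    positivity

/-- The coefficient of `(l - 1)²` in the smallest admissible length. -/
def lengthFactor (e : ℕ) : ℕ := 3 * e + 4 + (e + 1) * (4 * e ^ 2 + 10 * e + 7)

/-- The term of weight `L + s` in the count of heavy words. -/
theorem layer_bound {n e L j s : ℕ} (hL : 2 ≤ L) (hj : j ≤ e) (hs : 1 ≤ s)
    (hn : L * L * lengthFactor e + L ≤ n + 1) (hk : (j + s + 1) / 2 ≤ L) (N : ℕ)
    (hN : N ≤ (e + 1 + max j 1).choose ((j + s + 1) / 2) *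
      ((e + 1 + max j 1).choose ((j + s + 1) / 2) * ((e + 1).choose ((s - j) / 2) *
        n.choose (L - (j + s + 1) / 2)))) :
    4 * N ≤ n.choose L ∧ (3 ≤ s → 4 * 2 ^ ((s + 1) / 2) * N ≤ n.choose L) := by
  have hch := choose_sub_mul_pow_le hn _ hk
  have hu : (e + 1).choose ((s - j) / 2) ≤ (e + 1) ^ ((s - j) / 2) := Nat.choose_le_pow _ _
  rcases Nat.lt_or_ge ((j + s + 1) / 2) 2 with h | h
  · have h1 : (j + s + 1) / 2 = 1 := by omega
    have hj1 : max j 1 = 1 := by omega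
    refine ⟨?_, fun h3 => by omega⟩
    have hu' : (e + 1).choose ((s - j) / 2) ≤ e + 1 :=
      hu.trans ((Nat.pow_le_pow_right (by omega) (show (s - j) / 2 ≤ 1 by omega)).trans
        (by simp))
    rw [h1, hj1, Nat.choose_one_right] at hN
    rw [h1, pow_one] at hch
    set X := n.choose (L - 1)
    have hK : 4 * ((e + 2) * ((e + 2) * (e + 1))) ≤ L * lengthFactor e := by
      refine le_trans ?_ (Nat.mul_le_mul_right _ hL)
      unfold lengthFactor
      nlinarith
    calc 4 * N ≤ 4 * ((e + 2) * ((e + 2) * ((e + 1) * X))) := by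
          refine Nat.mul_le_mul_left _ (hN.trans ?_)
          gcongr
      _ = X * (4 * ((e + 2) * ((e + 2) * (e + 1)))) := by ring
      _ ≤ X * (L * lengthFactor e) := Nat.mul_le_mul_left _ hK
      _ ≤ _ := hch
  -- For `k ≥ 2` each of the two factors `a.choose k` is at most `a ^ k / 2`, which yields the
  -- constant 4; the factor `2 ^ k` is absorbed by `L ^ k`.
  · set k := (j + s + 1) / 2 with hkdef
    set X := n.choose (L - k)
    set a := e + 1 + max j 1
    have hfac : 2 ≤ k.factorial := h.trans k.self_le_factorial
    have hc : 2 * a.choose k ≤ a ^ k := by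
      have h1 : k.factorial * a.choose k = a.descFactorial k :=
        (Nat.descFactorial_eq_factorial_mul_choose a k).symm
      have h2 := Nat.descFactorial_le_pow a k
      calc 2 * a.choose k ≤ k.factorial * a.choose k := Nat.mul_le_mul_right _ hfac
        _ ≤ a ^ k := by rw [h1]; exact h2
    have hu' : (e + 1).choose ((s - j) / 2) ≤ (e + 1) ^ k :=
      hu.trans (Nat.pow_le_pow_right (by omega) (by omega))
    have hK : a * a * (e + 1) ≤ lengthFactor e := by
      have : a ≤ 2 * (e + 1) := by omega
      calc a * a * (e + 1) ≤ 2 * (e + 1) * (2 * (e + 1)) * (e + 1) := by gcongr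
        _ ≤ _ := by unfold lengthFactor; nlinarith
    have main : 4 * 2 ^ k * N ≤ n.choose L := by
      calc 4 * 2 ^ k * N ≤ 4 * L ^ k * (a.choose k * (a.choose k * ((e + 1) ^ k * X))) := by
            gcongr
            exact hN.trans (by gcongr)
        _ = L ^ k * ((2 * a.choose k) * (2 * a.choose k) * (e + 1) ^ k) * X := by ring
        _ ≤ L ^ k * (a ^ k * a ^ k * (e + 1) ^ k) * X := by gcongr
        _ = X * (L ^ k * (a * a * (e + 1)) ^ k) := by rw [mul_pow, mul_pow]; ring
        _ ≤ X * (L ^ k * lengthFactor e ^ k) := by gcongr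
        _ = X * (L * lengthFactor e) ^ k := by rw [mul_pow]
        _ ≤ _ := hch
    constructor
    · refine le_trans ?_ main
      have : 1 ≤ 2 ^ k := Nat.one_le_two_pow
      nlinarith
    · intro _
      refine le_trans ?_ main
      gcongr
      · norm_num
      · omega

/-- Words of weight at least `L` meeting three disjoint sets in many points are at most as many as
the words of weight `L`. -/
theorem card_heavy_le {e L j : ℕ} (hL : 2 ≤ L) (hj : j ≤ e)
    (hn : L * L * lengthFactor e + L ≤ Fintype.card α + 1) {A B C D : Finset α}
    (hAB : Disjoint A B) (hAC : Disjoint A C) (hBC : Disjoint B C)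
    (hA : A.card ≤ e + 1 + max j 1) (hB : B.card ≤ e + 1 + max j 1) (hC : C.card ≤ e + 1)
    (hD : D.card ≤ 3 * (e + 1)) (W : Finset (Finset α))
    (hW : ∀ w ∈ W, L ≤ w.card ∧ w.card + j ≤ L + 2 * (w ∩ A).card ∧
      w.card + j ≤ L + 2 * (w ∩ B).card ∧ w.card ≤ L + 1 + j + 2 * (w ∩ C).card ∧
      (w.card = L → 1 ≤ (w ∩ D).card)) :
    W.card ≤ (Fintype.card α).choose L := by
  set n := Fintype.card α
  have hfib := card_eq_sum_card_fiberwise (s := W) (t := range (n + 1))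
    (f := fun w => w.card - L) (by
      intro w hw
      have := card_le_univ w
      simp only [coe_range, Set.mem_Iio]
      omega)
  rw [hfib]
  have hlayer : ∀ s, 1 ≤ s →
      4 * (W.filter fun w => w.card - L = s).card ≤ n.choose L ∧
      (3 ≤ s → 4 * 2 ^ ((s + 1) / 2) * (W.filter fun w => w.card - L = s).card ≤ n.choose L) := by
    intro s hs
    by_cases hk : (j + s + 1) / 2 ≤ L
    · refine layer_bound hL hj hs hn hk _ ?_
      refine (card_le_choose_mul_choose hAB hAC hBC (L + s) ((j + s + 1) / 2) ((j + s + 1) / 2)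
        ((s - j) / 2) _ ?_).trans ?_
      · intro w hw
        obtain ⟨hw, hws⟩ := mem_filter.1 hw
        obtain ⟨h1, h2, h3, h4, -⟩ := hW w hw
        omega
      · have hmono : n.choose (L + s - ((j + s + 1) / 2 + (j + s + 1) / 2 + (s - j) / 2)) ≤
            n.choose (L - (j + s + 1) / 2) := by
          refine choose_le_choose_of_le hn (by omega) (by omega) ?_
          unfold lengthFactor
          nlinarith
        gcongr
    · have : W.filter (fun w => w.card - L = s) = ∅ := by
        refine filter_eq_empty_iff.2 fun w hw hws => ?_
        obtain ⟨h1, h2, h3, h4, -⟩ := hW w hw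
        have h5 : (w ∩ A).card + (w ∩ B).card + (w ∩ C).card ≤ w.card := by
          rw [← card_union_of_disjoint, ← card_union_of_disjoint]
          · exact card_le_card (union_subset (union_subset inter_subset_left inter_subset_left)
              inter_subset_left)
          · exact disjoint_union_left.2 ⟨hAC.mono inter_subset_right inter_subset_right,
              hBC.mono inter_subset_right inter_subset_right⟩
          · exact hAB.mono inter_subset_right inter_subset_right
        omega
      rw [this]
      simp
  refine sum_range_le_of_decay _ _ (fun s hs => ?_) (fun s hs => (hlayer s (by omega)).2 hs) _
  -- In weight exactly `L` the sets `A`, `B`, `C` need not be met at all when `j = 0`; the condition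
  -- on `D` saves the degree of freedom there.
  rcases Nat.eq_zero_or_pos s with rfl | h
  · have h0 := card_le_choose_mul_choose (disjoint_empty_right D) (disjoint_empty_right D)
      (disjoint_empty_right (∅ : Finset α)) L 1 0 0 (W.filter fun w => w.card - L = 0) (by
        intro w hw
        obtain ⟨hw, hws⟩ := mem_filter.1 hw
        obtain ⟨h1, h2, h3, h4, h5⟩ := hW w hw
        have : w.card = L := by omega
        exact ⟨this, h5 this, by omega, by omega⟩)
    simp only [Nat.choose_one_right, Nat.choose_zero_right, one_mul] at h0
    have hch := choose_sub_mul_pow_le hn 1 (by omega)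
    rw [pow_one] at hch
    have hK : 4 * (3 * (e + 1)) ≤ L * lengthFactor e := by
      refine le_trans ?_ (Nat.mul_le_mul_right _ hL)
      unfold lengthFactor
      nlinarith
    calc _ ≤ 4 * (3 * (e + 1) * n.choose (L - 1)) := by
          refine Nat.mul_le_mul_left _ (h0.trans ?_)
          exact Nat.mul_le_mul_right _ hD
      _ = n.choose (L - 1) * (4 * (3 * (e + 1))) := by ring
      _ ≤ n.choose (L - 1) * (L * lengthFactor e) := Nat.mul_le_mul_left _ hK
      _ ≤ _ := hch
  · exact (hlayer s h).1

end SetSystems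

/-! ### Shrinking the centres of three balls -/

section Shrinking

open Finset
open scoped symmDiff

theorem card_le_light_add_heavy {α : Type*} [Fintype α] (L : ℕ)
    (Y : Finset (Finset α)) :
    Y.card ≤ ∑ i ∈ range L, (Fintype.card α).choose i + (Y.filter fun w => L ≤ w.card).card := by
  rw [← card_filter_add_card_filter_not (s := Y) (fun w => L ≤ w.card), add_comm]
  refine Nat.add_le_add_right ?_ _
  rw [card_eq_sum_card_fiberwise (t := range L) (f := card) (by
    intro w hw
    simpa using (mem_filter.1 hw).2)]
  refine sum_le_sum fun i _ => ?_
  refine (card_le_card (t := powersetCard i univ) ?_).trans (by simp [card_powersetCard])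
  intro w hw
  simpa using (mem_filter.1 hw).2

variable {α : Type*} [DecidableEq α]

theorem card_erase_symmDiff_le {x : α} {B : Finset α} (hx : x ∉ B) (w : Finset α) :
    (w.erase x ∆ B).card ≤ (w ∆ B).card := by
  apply card_le_card
  intro y
  simp only [mem_symmDiff, mem_erase]
  grind

theorem disjoint_symmDiff_median (a b c : Finset α) :
    Disjoint ((a ∩ b ∪ a ∩ c ∪ b ∩ c) ∆ a) ((a ∩ b ∪ a ∩ c ∪ b ∩ c) ∆ b) ∧
    Disjoint ((a ∩ b ∪ a ∩ c ∪ b ∩ c) ∆ a) ((a ∩ b ∪ a ∩ c ∪ b ∩ c) ∆ c) ∧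
    Disjoint ((a ∩ b ∪ a ∩ c ∪ b ∩ c) ∆ b) ((a ∩ b ∪ a ∩ c ∪ b ∩ c) ∆ c) := by
  refine ⟨?_, ?_, ?_⟩ <;>
  · rw [disjoint_left]
    intro x
    simp only [mem_symmDiff, mem_union, mem_inter]
    tauto

theorem card_symmDiff_eq_add_of_disjoint {m a b : Finset α} (h : Disjoint (m ∆ a) (m ∆ b)) :
    (a ∆ b).card = (m ∆ a).card + (m ∆ b).card := by
  rw [← symmDiff_symmDiff_left_cancel m a b, ← card_union_of_disjoint h,
    symmDiff_eq_sup_sdiff_inf, h.eq_bot]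
  simp

theorem card_symmDiff_triangle (a b c : Finset α) :
    (a ∆ c).card ≤ (a ∆ b).card + (b ∆ c).card :=
  (card_le_card (symmDiff_triangle a b c)).trans (card_union_le _ _)

variable [Fintype α]

/-- A compression: words that leave the ball when `x` is removed from its centre contain `x`, and
deleting `x` brings them back. The deleted words lie outside the old ball, so they collide with no
word that was kept. -/
theorem card_filter_le_card_filter_erase (P : Finset α → Prop) [DecidablePred P] (t : ℕ)
    {A : Finset α} {x : α} (hx : x ∈ A) (hP : ∀ w, P w → P (w.erase x)) :
    (univ.filter fun w => P w ∧ (w ∆ A).card ≤ t).card ≤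
      (univ.filter fun w => P w ∧ (w ∆ A.erase x).card ≤ t).card := by
  have hmem : ∀ w, (w ∆ A).card ≤ t → ¬ (w ∆ A.erase x).card ≤ t → x ∈ w := by
    intro w h1 h2
    by_contra hxw
    refine h2 (le_trans (card_le_card ?_) h1)
    intro y
    simp only [mem_symmDiff, mem_erase]
    grind
  have hshift : ∀ w, x ∈ w → w.erase x ∆ A = w ∆ A.erase x := by
    intro w hw
    ext y
    simp only [mem_symmDiff, mem_erase]
    grind
  have hboth : ∀ w, x ∈ w → w.erase x ∆ A.erase x = w ∆ A := by
    intro w hw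
    ext y
    simp only [mem_symmDiff, mem_erase]
    grind
  refine card_le_card_of_injOn
    (fun w => if (w ∆ A.erase x).card ≤ t then w else w.erase x) ?_ ?_
  · intro w hw
    simp only [coe_filter, mem_univ, true_and, Set.mem_ofPred_eq] at hw ⊢
    split_ifs with h
    · exact ⟨hw.1, h⟩
    · exact ⟨hP w hw.1, by rw [hboth w (hmem w hw.2 h)]; exact hw.2⟩
  · intro v hv w hw hvw
    simp only [coe_filter, mem_univ, true_and, Set.mem_ofPred_eq] at hv hw hvw
    split_ifs at hvw with h1 h2 h2
    · exact hvw
    · have := hshift w (hmem w hw.2 h2)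
      rw [← hvw] at this
      exact absurd (this ▸ hv.2) h2
    · have := hshift v (hmem v hv.2 h1)
      rw [hvw] at this
      exact absurd (this ▸ hw.2) h1
    · rw [← insert_erase (hmem v hv.2 h1), hvw, insert_erase (hmem w hw.2 h2)]

theorem card_filter_le_card_filter_subset (P : Finset α → Prop) [DecidablePred P] (t : ℕ)
    {A A' : Finset α} (hA : A' ⊆ A) (hP : ∀ x ∈ A, ∀ w, P w → P (w.erase x)) :
    (univ.filter fun w => P w ∧ (w ∆ A).card ≤ t).card ≤
      (univ.filter fun w => P w ∧ (w ∆ A').card ≤ t).card := by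
  induction hk : (A \ A').card generalizing A with
  | zero =>
    rw [card_eq_zero, sdiff_eq_empty_iff_subset] at hk
    rw [hA.antisymm hk]
  | succ k ih =>
    obtain ⟨x, hx⟩ : (A \ A').Nonempty := card_pos.1 (by omega)
    obtain ⟨hxA, hxA'⟩ := mem_sdiff.1 hx
    refine (card_filter_le_card_filter_erase P t hxA (hP x hxA)).trans (ih ?_ ?_ ?_)
    · exact subset_erase.2 ⟨hA, hxA'⟩
    · exact fun y hy => hP y (mem_of_mem_erase hy)
    · rw [erase_sdiff_comm, card_erase_of_mem hx, hk]
      rfl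

/-- Moving the centre of one of three balls towards the other two enlarges the intersection. -/
theorem card_three_balls_le {A A' B C : Finset α} (hA : A' ⊆ A) (hAB : Disjoint A B)
    (hAC : Disjoint A C) (t : ℕ) :
    (univ.filter fun w => ((w ∆ B).card ≤ t ∧ (w ∆ C).card ≤ t) ∧ (w ∆ A).card ≤ t).card ≤
      (univ.filter fun w => ((w ∆ B).card ≤ t ∧ (w ∆ C).card ≤ t) ∧ (w ∆ A').card ≤ t).card :=
  card_filter_le_card_filter_subset _ t hA fun _ hx w hw =>
    ⟨(card_erase_symmDiff_le (disjoint_left.1 hAB hx) w).trans hw.1,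
      (card_erase_symmDiff_le (disjoint_left.1 hAC hx) w).trans hw.2⟩

theorem card_three_balls_le_of_subset {A A' B B' C C' : Finset α} (hA : A' ⊆ A) (hB : B' ⊆ B)
    (hC : C' ⊆ C) (hAB : Disjoint A B) (hAC : Disjoint A C) (hBC : Disjoint B C) (t : ℕ) :
    (univ.filter fun w => ((w ∆ B).card ≤ t ∧ (w ∆ C).card ≤ t) ∧ (w ∆ A).card ≤ t).card ≤
      (univ.filter fun w =>
        ((w ∆ B').card ≤ t ∧ (w ∆ C').card ≤ t) ∧ (w ∆ A').card ≤ t).card := by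
  have rot : ∀ X Y Z : Finset α,
      (univ.filter fun w => ((w ∆ Y).card ≤ t ∧ (w ∆ Z).card ≤ t) ∧ (w ∆ X).card ≤ t) =
      (univ.filter fun w => ((w ∆ Z).card ≤ t ∧ (w ∆ X).card ≤ t) ∧ (w ∆ Y).card ≤ t) := by
    intro X Y Z
    refine filter_congr fun w _ => ?_
    tauto
  refine (card_three_balls_le hA hAB hAC t).trans ?_
  rw [rot, rot A' B' C']
  refine (card_three_balls_le hB hBC (hAB.symm.mono_right hA) t).trans ?_
  rw [rot, rot B' C' A']
  exact card_three_balls_le hC (hAC.symm.mono_right hA) (hBC.symm.mono_right hB) t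

end Shrinking

/-! ### Upper bound for the number of outputs -/

section UpperBound

open Finset
open scoped symmDiff

variable {α : Type*} [Fintype α] [DecidableEq α]

theorem card_le_of_far_sorted {e L : ℕ} (hL : 2 ≤ L)
    (hn : L * L * lengthFactor e + L ≤ Fintype.card α + 1) {A B C : Finset α}
    (hAB : Disjoint A B) (hAC : Disjoint A C) (hBC : Disjoint B C) (hBA : B.card ≤ A.card)
    (hCB : C.card ≤ B.card) (hA : e + 2 ≤ A.card) (hsum : 2 * e + 1 ≤ B.card + C.card)
    (Y : Finset (Finset α)) (hY : ∀ y ∈ Y, (y ∆ A).card ≤ e + (L + 1) ∧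
      (y ∆ B).card ≤ e + (L + 1) ∧ (y ∆ C).card ≤ e + (L + 1)) :
    Y.card ≤ ∑ i ∈ range (L + 1), (Fintype.card α).choose i := by
  -- The truncated deficit of the smallest set below `e`. The pair condition forces the other two up
  -- to `e + 1 + j`, and trimming to these sizes makes them bounded, as counting requires.
  obtain ⟨j, hj⟩ : ∃ j, j = e - C.card := ⟨_, rfl⟩
  obtain ⟨A', hA', hA'c⟩ := exists_subset_card_eq (show e + 1 + max j 1 ≤ A.card by omega)
  obtain ⟨B', hB', hB'c⟩ := exists_subset_card_eq (show e + 1 + j ≤ B.card by omega)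
  obtain ⟨C', hC', hC'c⟩ := exists_subset_card_eq (show e - j ≤ C.card by omega)
  set Z := univ.filter fun w : Finset α => ((w ∆ B').card ≤ e + (L + 1) ∧
    (w ∆ C').card ≤ e + (L + 1)) ∧ (w ∆ A').card ≤ e + (L + 1)
  have hYZ : Y.card ≤ Z.card := by
    refine le_trans (card_le_card ?_) (card_three_balls_le_of_subset hA' hB' hC' hAB hAC hBC _)
    intro y hy
    have := hY y hy
    simp only [mem_filter, mem_univ, true_and]
    tauto
  refine hYZ.trans ((card_le_light_add_heavy L Z).trans ?_)
  rw [sum_range_succ]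
  refine Nat.add_le_add_left ?_ _
  refine card_heavy_le hL (show j ≤ e by omega) hn (hAB.mono hA' hB') (hAC.mono hA' hC')
    (hBC.mono hB' hC') (D := A') (by omega) (by omega) (by omega) (by omega) _ ?_
  intro w hw
  simp only [Z, mem_filter, mem_univ, true_and] at hw
  have h1 := card_symmDiff_add_two_mul_card_inter w A'
  have h2 := card_symmDiff_add_two_mul_card_inter w B'
  have h3 := card_symmDiff_add_two_mul_card_inter w C'
  omega

theorem card_le_of_far {e L : ℕ} (hL : 2 ≤ L)
    (hn : L * L * lengthFactor e + L ≤ Fintype.card α + 1) {A B C : Finset α}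
    (hAB : Disjoint A B) (hAC : Disjoint A C) (hBC : Disjoint B C)
    (hfar : e + 2 ≤ A.card ∨ e + 2 ≤ B.card ∨ e + 2 ≤ C.card)
    (hsAB : 2 * e + 1 ≤ A.card + B.card) (hsAC : 2 * e + 1 ≤ A.card + C.card)
    (hsBC : 2 * e + 1 ≤ B.card + C.card)
    (Y : Finset (Finset α)) (hY : ∀ y ∈ Y, (y ∆ A).card ≤ e + (L + 1) ∧
      (y ∆ B).card ≤ e + (L + 1) ∧ (y ∆ C).card ≤ e + (L + 1)) :
    Y.card ≤ ∑ i ∈ range (L + 1), (Fintype.card α).choose i := by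
  rcases le_total A.card B.card with h1 | h1 <;> rcases le_total B.card C.card with h2 | h2 <;>
    rcases le_total A.card C.card with h3 | h3
  · exact card_le_of_far_sorted hL hn hBC.symm hAC.symm hAB.symm h2 h1 (by omega) (by omega) Y
      fun y hy => ⟨(hY y hy).2.2, (hY y hy).2.1, (hY y hy).1⟩
  · exact card_le_of_far_sorted hL hn hBC.symm hAC.symm hAB.symm h2 h1 (by omega) (by omega) Y
      fun y hy => ⟨(hY y hy).2.2, (hY y hy).2.1, (hY y hy).1⟩
  · exact card_le_of_far_sorted hL hn hBC hAB.symm hAC.symm h2 h3 (by omega) (by omega) Y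
      fun y hy => ⟨(hY y hy).2.1, (hY y hy).2.2, (hY y hy).1⟩
  · exact card_le_of_far_sorted hL hn hAB.symm hBC hAC h1 h3 (by omega) (by omega) Y
      fun y hy => ⟨(hY y hy).2.1, (hY y hy).1, (hY y hy).2.2⟩
  · exact card_le_of_far_sorted hL hn hAC.symm hBC.symm hAB h3 h1 (by omega) (by omega) Y
      fun y hy => ⟨(hY y hy).2.2, (hY y hy).1, (hY y hy).2.1⟩
  · exact card_le_of_far_sorted hL hn hAC hAB hBC.symm h3 h2 (by omega) (by omega) Y
      fun y hy => ⟨(hY y hy).1, (hY y hy).2.2, (hY y hy).2.1⟩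
  · exact card_le_of_far_sorted hL hn hAB hAC hBC h1 h2 (by omega) (by omega) Y hY
  · exact card_le_of_far_sorted hL hn hAB hAC hBC h1 h2 (by omega) (by omega) Y hY

/-- At most one of `A`, `B`, `C` has size `e`, so two of size `e + 1` serve as the first two sets
with `j = 0`. Since `D` has size at least `e + 2`, every output of weight `L` meets it. -/
theorem card_le_of_near_and_far {e L : ℕ} (hL : 2 ≤ L)
    (hn : L * L * lengthFactor e + L ≤ Fintype.card α + 1) {A B C D : Finset α}
    (hAB : Disjoint A B) (hAC : Disjoint A C) (hBC : Disjoint B C)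
    (hA : A.card ≤ e + 1) (hB : B.card ≤ e + 1) (hC : C.card ≤ e + 1)
    (hD : e + 2 ≤ D.card) (hD' : D.card ≤ 3 * (e + 1))
    (hsAB : 2 * e + 1 ≤ A.card + B.card) (hsAC : 2 * e + 1 ≤ A.card + C.card)
    (hsBC : 2 * e + 1 ≤ B.card + C.card)
    (Y : Finset (Finset α)) (hY : ∀ y ∈ Y, (y ∆ A).card ≤ e + (L + 1) ∧
      (y ∆ B).card ≤ e + (L + 1) ∧ (y ∆ C).card ≤ e + (L + 1) ∧ (y ∆ D).card ≤ e + (L + 1)) :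
    Y.card ≤ ∑ i ∈ range (L + 1), (Fintype.card α).choose i := by
  refine (card_le_light_add_heavy L Y).trans ?_
  rw [sum_range_succ]
  refine Nat.add_le_add_left ?_ _
  have hw : ∀ w ∈ Y.filter (fun w => L ≤ w.card), L ≤ w.card ∧
      w.card + A.card ≤ e + (L + 1) + 2 * (w ∩ A).card ∧
      w.card + B.card ≤ e + (L + 1) + 2 * (w ∩ B).card ∧
      w.card + C.card ≤ e + (L + 1) + 2 * (w ∩ C).card ∧
      w.card + D.card ≤ e + (L + 1) + 2 * (w ∩ D).card := by
    intro w hw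
    obtain ⟨hw, hwL⟩ := mem_filter.1 hw
    obtain ⟨hyA, hyB, hyC, hyD⟩ := hY w hw
    have h1 := card_symmDiff_add_two_mul_card_inter w A
    have h2 := card_symmDiff_add_two_mul_card_inter w B
    have h3 := card_symmDiff_add_two_mul_card_inter w C
    have h4 := card_symmDiff_add_two_mul_card_inter w D
    omega
  have hmax : max 0 1 = 1 := rfl
  by_cases hAe : A.card = e + 1
  · by_cases hBe : B.card = e + 1
    · refine card_heavy_le hL e.zero_le hn hAB hAC hBC (by omega) (by omega) hC hD' _ ?_
      intro w hw'
      have := hw w hw'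
      omega
    · refine card_heavy_le hL e.zero_le hn hAC hAB hBC.symm (by omega) (by omega) hB hD' _ ?_
      intro w hw'
      have := hw w hw'
      omega
  · refine card_heavy_le hL e.zero_le hn hBC hAB.symm hAC.symm (by omega) (by omega) hA hD' _ ?_
    intro w hw'
    have := hw w hw'
    omega

/-- The separation makes the sets of `T` disjoint, with at most one of size `e` and the others of
size `e + 1`. For weight `L + s` with `s ≥ 1`, the forced intersections already exhaust the word, so
it is a transversal, except that it may miss the set of size `e`. -/
theorem card_le_of_centered {e L : ℕ} (hL : 2 ≤ L) (T : Finset (Finset α))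
    (hT : T.card = L + 2) (hTe : ∀ c ∈ T, c.card ≤ e + 1)
    (hsep : ∀ c ∈ T, ∀ d ∈ T, c ≠ d → 2 * e + 1 ≤ (c ∆ d).card)
    (Y : Finset (Finset α)) (hY : ∀ y ∈ Y, ∀ c ∈ T, (y ∆ c).card ≤ e + (L + 1)) :
    Y.card ≤ ∑ i ∈ range (L + 1), (Fintype.card α).choose i + (e + 1) ^ (L + 2) := by
  refine (card_le_light_add_heavy (L + 1) Y).trans (Nat.add_le_add_left ?_ _)
  have hpair : ∀ c ∈ T, ∀ d ∈ T, c ≠ d → Disjoint c d ∧ 2 * e + 1 ≤ c.card + d.card := by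
    intro c hc d hd hcd
    have h1 := hsep c hc d hd hcd
    have h2 := card_symmDiff_add_two_mul_card_inter c d
    have h3 := hTe c hc
    have h4 := hTe d hd
    refine ⟨?_, by omega⟩
    rw [disjoint_iff_inter_eq_empty, ← card_eq_zero]
    omega
  have hdisj : ∀ w : Finset α, ∑ c ∈ T, (w ∩ c).card = (T.biUnion fun c => w ∩ c).card := by
    intro w
    rw [card_biUnion]
    intro c hc d hd hcd
    exact (hpair c hc d hd hcd).1.mono inter_subset_right inter_subset_right
  have hsub : ∀ w : Finset α, (T.biUnion fun c => w ∩ c) ⊆ w := fun w =>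
    biUnion_subset.2 fun c _ => inter_subset_left
  have hge : ∀ c ∈ T, e ≤ c.card := by
    intro c hc
    obtain ⟨d, hd, hdc⟩ := exists_mem_ne (show 1 < T.card by omega) c
    have h1 := (hpair c hc d hd hdc.symm).2
    have h2 := hTe d hd
    omega
  -- the total weight and the lower bound for the intersections with the supports
  have hone : (L + 2) * (e + 1) ≤ ∑ c ∈ T, c.card + 1 ∧ ∀ s, 1 ≤ s → s ≤ 2 →
      L + s ≤ ∑ c ∈ T, (if c.card = e + 1 then 1 else s - 1) := by
    by_cases h : ∀ c ∈ T, c.card = e + 1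
    · rw [sum_congr rfl h]
      refine ⟨by simp [hT], fun s h1 h2 => ?_⟩
      rw [sum_congr rfl (g := fun _ => 1) fun c hc => if_pos (h c hc)]
      simp [hT, h2]
    · push Not at h
      obtain ⟨c₀, hc₀, hne⟩ := h
      have hoth : ∀ c ∈ T.erase c₀, c.card = e + 1 := by
        intro c hc
        obtain ⟨hc1, hc2⟩ := mem_erase.1 hc
        have h1 := (hpair c hc2 c₀ hc₀ hc1).2
        have h2 := hTe c hc2
        have h3 := hTe c₀ hc₀
        omega
      have hcard : (T.erase c₀).card = L + 1 := by rw [card_erase_of_mem hc₀, hT]; rfl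
      constructor
      · rw [← add_sum_erase T _ hc₀, sum_congr rfl hoth]
        have := hge c₀ hc₀
        simp only [sum_const, hcard, smul_eq_mul]
        nlinarith
      · intro s h1 h2
        rw [← add_sum_erase T _ hc₀, if_neg hne,
          sum_congr rfl (g := fun _ => 1) fun c hc => if_pos (hoth c hc)]
        simp only [sum_const, hcard, smul_eq_mul]
        omega
  have hstruct : ∀ w ∈ Y.filter (fun w => L + 1 ≤ w.card),
      (T.biUnion fun c => w ∩ c) = w ∧ ∀ c ∈ T, (w ∩ c).card ≤ 1 ∧
        (c.card = e + 1 → (w ∩ c).card = 1) := by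
    intro w hw
    obtain ⟨hwY, hwL⟩ := mem_filter.1 hw
    obtain ⟨s, hs⟩ : ∃ s, w.card = L + s := ⟨w.card - L, by omega⟩
    have hx : ∀ c ∈ T, s + c.card ≤ (e + 1) + 2 * (w ∩ c).card := by
      intro c hc
      have h1 := hY w hwY c hc
      have h2 := card_symmDiff_add_two_mul_card_inter w c
      omega
    have hle : ∑ c ∈ T, (w ∩ c).card ≤ L + s := by
      rw [hdisj, ← hs]
      exact card_le_card (hsub w)
    have hsum := sum_le_sum hx
    rw [sum_add_distrib, sum_add_distrib, ← mul_sum] at hsum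
    simp only [sum_const, hT, smul_eq_mul] at hsum
    -- Summing the distance conditions over `T` gives `L * s ≤ 2 * L + 1`.
    have hs2 : s ≤ 2 := by
      have := hone.1
      by_contra! h3
      nlinarith
    have hlow : ∀ c ∈ T, (if c.card = e + 1 then 1 else s - 1) ≤ (w ∩ c).card := by
      intro c hc
      have h1 := hx c hc
      have h2 := hge c hc
      split_ifs with h <;> omega
    have h4 := hone.2 s (by omega) hs2
    have h5 := sum_le_sum hlow
    have heq := (sum_eq_sum_iff_of_le hlow).1 (by omega)
    refine ⟨eq_of_subset_of_card_le (hsub w) ?_, fun c hc => ?_⟩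
    · rw [← hdisj]
      omega
    · have := heq c hc
      split_ifs at this with h <;> omega
  -- The possible traces on `c`: for size `e` the empty trace is the extra option, so there are at
  -- most `e + 1` in both cases.
  let fam : Finset α → Finset (Finset α) := fun c =>
    if c.card = e + 1 then powersetCard 1 c else insert ∅ (powersetCard 1 c)
  have hfam : ∀ c ∈ T, (fam c).card ≤ e + 1 := by
    intro c hc
    have := hTe c hc
    simp only [fam]
    split_ifs with h
    · simp [h]
    · refine (card_insert_le _ _).trans ?_
      simp only [card_powersetCard, Nat.choose_one_right]
      omega
  calc _ ≤ (T.pi fam).card := by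
        refine card_le_card_of_injOn (fun w c _ => w ∩ c) ?_ ?_
        · intro w hw
          simp only [mem_coe, mem_pi]
          intro c hc
          obtain ⟨h1, h2⟩ := (hstruct w hw).2 c hc
          simp only [fam]
          split_ifs with h
          · exact mem_powersetCard.2 ⟨inter_subset_right, h2 h⟩
          · rcases Nat.le_one_iff_eq_zero_or_eq_one.1 h1 with h3 | h3
            · rw [card_eq_zero.1 h3]
              exact mem_insert_self _ _
            · exact mem_insert_of_mem (mem_powersetCard.2 ⟨inter_subset_right, h3⟩)
        · intro v hv w hw hvw
          rw [← (hstruct v hv).1, ← (hstruct w hw).1]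
          refine biUnion_congr rfl fun c hc => ?_
          exact congrFun (congrFun hvw c) hc
    _ = ∏ c ∈ T, (fam c).card := card_pi _ _
    _ ≤ (e + 1) ^ T.card := prod_le_pow_card _ _ _ hfam
    _ = (e + 1) ^ (L + 2) := by rw [hT]

/-- The intersection of `L + 2` balls of radius `e + L + 1` whose centres are far apart. -/
theorem card_le_of_separated {e L : ℕ} (hL : 2 ≤ L)
    (hn : L * L * lengthFactor e + L ≤ Fintype.card α + 1) (T : Finset (Finset α))
    (hT : L + 2 ≤ T.card) (hsep : ∀ c ∈ T, ∀ d ∈ T, c ≠ d → 2 * e + 1 ≤ (c ∆ d).card)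
    (Y : Finset (Finset α)) (hY : ∀ y ∈ Y, ∀ c ∈ T, (y ∆ c).card ≤ e + (L + 1)) :
    Y.card ≤ ∑ i ∈ range (L + 1), (Fintype.card α).choose i + (e + 1) ^ (L + 2) := by
  have hinj : ∀ m : Finset α, Function.Injective fun y => m ∆ y := fun m =>
    symmDiff_right_injective m
  have hYm : ∀ m : Finset α, ∀ y ∈ Y.image (fun y => m ∆ y), ∀ c ∈ T,
      (y ∆ (m ∆ c)).card ≤ e + (L + 1) := by
    intro m y hy c hc
    obtain ⟨y, hy', rfl⟩ := mem_image.1 hy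
    rw [symmDiff_symmDiff_left_cancel]
    exact hY y hy' c hc
  by_contra! hbig
  have hbig' : ∑ i ∈ range (L + 1), (Fintype.card α).choose i < Y.card := by omega
  have hnear : ∀ a ∈ T, ∀ b ∈ T, ∀ c ∈ T, a ≠ b → a ≠ c → b ≠ c →
      ((a ∩ b ∪ a ∩ c ∪ b ∩ c) ∆ a).card ≤ e + 1 ∧ ((a ∩ b ∪ a ∩ c ∪ b ∩ c) ∆ b).card ≤ e + 1 ∧
      ((a ∩ b ∪ a ∩ c ∪ b ∩ c) ∆ c).card ≤ e + 1 := by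
    intro a ha b hb c hc hab hac hbc
    obtain ⟨d1, d2, d3⟩ := disjoint_symmDiff_median a b c
    set m := a ∩ b ∪ a ∩ c ∪ b ∩ c
    have s1 := hsep a ha b hb hab
    have s2 := hsep a ha c hc hac
    have s3 := hsep b hb c hc hbc
    rw [card_symmDiff_eq_add_of_disjoint d1] at s1
    rw [card_symmDiff_eq_add_of_disjoint d2] at s2
    rw [card_symmDiff_eq_add_of_disjoint d3] at s3
    by_contra hcon
    have := card_le_of_far hL hn d1 d2 d3 (by omega) s1 s2 s3 (Y.image fun y => m ∆ y)
      fun y hy => ⟨hYm m y hy a ha, hYm m y hy b hb, hYm m y hy c hc⟩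
    rw [card_image_of_injective _ (hinj m)] at this
    omega
  obtain ⟨a, ha, b, hb, c, hc, hab, hac, hbc⟩ := two_lt_card.1 (show 2 < T.card by omega)
  obtain ⟨n1, n2, n3⟩ := hnear a ha b hb c hc hab hac hbc
  obtain ⟨d1, d2, d3⟩ := disjoint_symmDiff_median a b c
  set m := a ∩ b ∪ a ∩ c ∪ b ∩ c
  by_cases hcen : ∀ d ∈ T, (m ∆ d).card ≤ e + 1
  · obtain ⟨T', hT', hT'c⟩ := exists_subset_card_eq hT
    have := card_le_of_centered (e := e) hL (T'.image fun y => m ∆ y)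
      (by rw [card_image_of_injective _ (hinj m), hT'c])
      (by
        intro d hd
        obtain ⟨d, hd', rfl⟩ := mem_image.1 hd
        exact hcen d (hT' hd'))
      (by
        intro d hd d' hd' hne
        obtain ⟨d, hd₁, rfl⟩ := mem_image.1 hd
        obtain ⟨d', hd₂, rfl⟩ := mem_image.1 hd'
        rw [symmDiff_symmDiff_left_cancel]
        exact hsep d (hT' hd₁) d' (hT' hd₂) fun h => hne (by rw [h]))
      (Y.image fun y => m ∆ y) (by
        intro y hy d hd
        obtain ⟨d, hd', rfl⟩ := mem_image.1 hd
        exact hYm m y hy d (hT' hd'))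
    rw [card_image_of_injective _ (hinj m)] at this
    omega
  · push Not at hcen
    obtain ⟨d, hd, hdm⟩ := hcen
    have hda : d ≠ a := by rintro rfl; omega
    have hdb : d ≠ b := by rintro rfl; omega
    -- Nearness of the triple `a, d, b` to its own median puts `d` within `2(e + 1)` of `a`, hence
    -- within `3(e + 1)` of `m`.
    obtain ⟨p1, p2, -⟩ := hnear a ha d hd b hb hda.symm hab hdb
    have p3 := card_symmDiff_eq_add_of_disjoint (disjoint_symmDiff_median a d b).1
    have p4 := card_symmDiff_triangle m a d
    have s1 := hsep a ha b hb hab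
    have s2 := hsep a ha c hc hac
    have s3 := hsep b hb c hc hbc
    rw [card_symmDiff_eq_add_of_disjoint d1] at s1
    rw [card_symmDiff_eq_add_of_disjoint d2] at s2
    rw [card_symmDiff_eq_add_of_disjoint d3] at s3
    have := card_le_of_near_and_far hL hn d1 d2 d3 n1 n2 n3 (D := m ∆ d) (by omega) (by omega)
      s1 s2 s3 (Y.image fun y => m ∆ y)
      fun y hy => ⟨hYm m y hy a ha, hYm m y hy b hb, hYm m y hy c hc, hYm m y hy d hd⟩
    rw [card_image_of_injective _ (hinj m)] at this
    omega

end UpperBound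

/-! ### A family attaining the bound -/

section Construction

open Finset
open scoped symmDiff

variable {α : Type*} [Fintype α] [DecidableEq α]

/-- The centres `S i` are the blocks of `φ`; `Y` consists of all words of weight below `l` and all
transversals of the `l + 1` blocks. The word `v`, a transversal of all blocks but the last, has
weight `l` and so is not in `Y`. -/
theorem exists_large_output_families {e l : ℕ} (hl : 1 ≤ l) (φ : Fin (l + 1) × Fin (e + 1) ↪ α) :
    ∃ (S : Fin (l + 1) → Finset α) (Y : Finset (Finset α)) (v : Finset α),
      (∀ i j, i ≠ j → 2 * e + 1 ≤ (S i ∆ S j).card) ∧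
      Y.card = ∑ i ∈ range l, (Fintype.card α).choose i + (e + 1) ^ (l + 1) ∧
      (∀ y ∈ Y, ∀ i, (y ∆ S i).card ≤ e + l) ∧ v ∉ Y ∧
      ∀ i, i ≠ Fin.last l → (v ∆ S i).card ≤ e + l := by
  let S : Fin (l + 1) → Finset α := fun i => univ.image fun j => φ (i, j)
  let W : Finset (Fin (l + 1)) → (Fin (l + 1) → Fin (e + 1)) → Finset α :=
    fun I g => I.image fun i => φ (i, g i)
  have hS : ∀ i, (S i).card = e + 1 := fun i => by
    simp only [S]
    rw [card_image_of_injective _ fun a b h => by simpa using h]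
    simp
  have hW : ∀ I g, (W I g).card = I.card := fun I g =>
    card_image_of_injective _ fun a b h => by
      have := φ.injective h
      simp only [Prod.mk.injEq] at this
      exact this.1
  have hWS : ∀ I g, ∀ i ∈ I, (W I g ∆ S i).card ≤ I.card + e - 1 := by
    intro I g i hi
    have h1 := card_symmDiff_add_two_mul_card_inter (W I g) (S i)
    have h2 : 0 < (W I g ∩ S i).card := card_pos.2 ⟨φ (i, g i), mem_inter.2
      ⟨mem_image_of_mem (fun i => φ (i, g i)) hi, mem_image_of_mem (fun j => φ (i, j)) (mem_univ _)⟩⟩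
    rw [hW, hS] at h1
    omega
  have hWinj : Function.Injective (W univ) := by
    intro g g' h
    funext i
    have : φ (i, g i) ∈ W univ g' := h ▸ mem_image_of_mem (fun i => φ (i, g i)) (mem_univ i)
    obtain ⟨i', -, hi'⟩ := mem_image.1 this
    have := φ.injective hi'
    simp only [Prod.mk.injEq] at this
    obtain ⟨rfl, h⟩ := this
    exact h.symm
  let B : Finset (Finset α) := (range l).biUnion fun i => powersetCard i univ
  have hBmem : ∀ w, w ∈ B ↔ w.card < l := fun w => by simp [B]
  have hB : B.card = ∑ i ∈ range l, (Fintype.card α).choose i := by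
    rw [card_biUnion]
    · simp [card_powersetCard]
    · intro i _ j _ hij
      rw [Function.onFun, disjoint_left]
      simp only [mem_powersetCard, subset_univ, true_and]
      intro w h1 h2
      exact hij (h1.symm.trans h2)
  refine ⟨S, B ∪ univ.image (W univ), W (univ.erase (Fin.last l)) 0, ?_, ?_, ?_, ?_, ?_⟩
  · intro i j hij
    have h1 := card_symmDiff_add_two_mul_card_inter (S i) (S j)
    have h2 : S i ∩ S j = ∅ := by
      rw [← disjoint_iff_inter_eq_empty, disjoint_left]
      intro x hx hx'
      obtain ⟨a, -, rfl⟩ := mem_image.1 hx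
      obtain ⟨b, -, hb⟩ := mem_image.1 hx'
      have := φ.injective hb
      simp only [Prod.mk.injEq] at this
      exact hij this.1.symm
    rw [h2, hS, hS, card_empty] at h1
    omega
  · rw [card_union_of_disjoint, hB, card_image_of_injective _ hWinj]
    · simp
    · rw [disjoint_left]
      intro w hw hw'
      obtain ⟨g, -, rfl⟩ := mem_image.1 hw'
      rw [hBmem, hW, card_univ, Fintype.card_fin] at hw
      omega
  · intro y hy i
    rcases mem_union.1 hy with hy | hy
    · have h1 := card_symmDiff_add_two_mul_card_inter y (S i)
      rw [hBmem] at hy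
      rw [hS] at h1
      omega
    · obtain ⟨g, -, rfl⟩ := mem_image.1 hy
      have := hWS univ g i (mem_univ i)
      rw [card_univ, Fintype.card_fin] at this
      omega
  · rw [mem_union, not_or]
    have hc : (W (univ.erase (Fin.last l)) 0).card = l := by
      rw [hW, card_erase_of_mem (mem_univ _), card_univ, Fintype.card_fin]
      rfl
    refine ⟨by rw [hBmem]; omega, fun h => ?_⟩
    obtain ⟨g, -, hg⟩ := mem_image.1 h
    rw [← hg, hW, card_univ, Fintype.card_fin] at hc
    omega
  · intro i hi
    have := hWS (univ.erase (Fin.last l)) 0 i (mem_erase.2 ⟨hi, mem_univ i⟩)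
    rw [card_erase_of_mem (mem_univ _), card_univ, Fintype.card_fin] at this
    omega

end Construction

/-! ### From sets back to binary words -/

section Words

open Finset
open scoped symmDiff

variable {n : ℕ}

/-- The support of a binary word. -/
def wordSupport (x : BinaryWord n) : Finset (Fin n) := univ.filter fun i => x i ≠ 0

/-- The characteristic word of a set of coordinates. -/
def wordOfSet (s : Finset (Fin n)) : BinaryWord n := fun i => if i ∈ s then 1 else 0

theorem wordSupport_wordOfSet (s : Finset (Fin n)) : wordSupport (wordOfSet s) = s := by
  ext i
  simp [wordSupport, wordOfSet]

theorem wordOfSet_injective : Function.Injective (wordOfSet (n := n)) :=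
  Function.LeftInverse.injective wordSupport_wordOfSet

theorem hammingDist_eq_card_symmDiff (x y : BinaryWord n) :
    hammingDist x y = (wordSupport x ∆ wordSupport y).card := by
  unfold hammingDist
  congr 1
  ext i
  simp only [mem_filter, mem_univ, true_and, mem_symmDiff, wordSupport]
  generalize x i = a
  generalize y i = b
  revert a b
  decide

theorem wordSupport_injective : Function.Injective (wordSupport (n := n)) := by
  intro x y h
  rw [← hammingDist_eq_zero, hammingDist_eq_card_symmDiff, h]
  simp

theorem hammingDist_wordOfSet (s t : Finset (Fin n)) :
    hammingDist (wordOfSet s) (wordOfSet t) = (s ∆ t).card := by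
  rw [hammingDist_eq_card_symmDiff, wordSupport_wordOfSet, wordSupport_wordOfSet]

theorem mem_outputList {C Y : Finset (BinaryWord n)} {t : ℕ} {c : BinaryWord n} :
    c ∈ outputList C t Y ↔ c ∈ C ∧ ∀ y ∈ Y, hammingDist y c ≤ t := by
  simp [outputList, hammingBall]

/-- The coefficient of `L ^ 2` in `lengthBound` is bounded below by its value at `b = 4e + 4`, which
is exactly `lengthFactor e`. -/
theorem le_of_lengthBound_le {e L b : ℕ} (hb : 4 * e + 4 ≤ b)
    (hn : lengthBound e (L + 1) b ≤ (n : ℤ)) : L * L * lengthFactor e + L ≤ n + 1 := by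
  have hch : (2 * e + 3) * (e + 1) ≤ (b - 2 * e - 1).choose 2 := by
    have h1 : (2 * e + 3).choose 2 = (2 * e + 3) * (e + 1) := by
      rw [Nat.choose_two_right, show 2 * e + 3 - 1 = 2 * (e + 1) by omega,
        Nat.div_eq_of_eq_mul_left two_pos]
      ring
    rw [← h1]
    exact Nat.choose_le_choose 2 (by omega)
  have hK : (lengthFactor e : ℤ) ≤ (b : ℤ) - e + ((e : ℤ) + 1) *
      ((b : ℤ) - 3 * e - 2 * (e : ℤ) ^ 2 + (e : ℤ) * b + ((b - 2 * e - 1).choose 2 : ℕ)) := by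
    have hch' : (2 * (e : ℤ) + 3) * (e + 1) ≤ ((b - 2 * e - 1).choose 2 : ℕ) := by
      exact_mod_cast hch
    have hb' : 4 * (e : ℤ) + 4 ≤ b := by exact_mod_cast hb
    have h2 : (e : ℤ) * (4 * e + 4) ≤ e * b := mul_le_mul_of_nonneg_left hb' (by positivity)
    have h3 : (4 * (e : ℤ) ^ 2 + 10 * e + 7) ≤ (b : ℤ) - 3 * e - 2 * (e : ℤ) ^ 2 + (e : ℤ) * b +
        ((b - 2 * e - 1).choose 2 : ℕ) := by linarith
    have h4 := mul_le_mul_of_nonneg_left h3 (show (0 : ℤ) ≤ e + 1 by positivity)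
    unfold lengthFactor
    push_cast
    linarith
  have h5 := mul_le_mul_of_nonneg_left hK (show (0 : ℤ) ≤ (L : ℤ) ^ 2 by positivity)
  unfold lengthBound at hn
  push_cast at hn
  rw [show (L : ℤ) + 1 - 1 = L by ring] at hn
  have : ((L * L * lengthFactor e + L : ℕ) : ℤ) ≤ ((n + 1 : ℕ) : ℤ) := by
    push_cast
    nlinarith
  exact_mod_cast this

theorem card_le_of_lt_card_outputList {e L : ℕ} (hL : 2 ≤ L)
    (hn : L * L * lengthFactor e + L ≤ n + 1) {C Y : Finset (BinaryWord n)}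
    (hC : IsErrorCorrecting e C) (h : L + 2 ≤ (outputList C (e + (L + 1)) Y).card) :
    Y.card ≤ ballVolume n L + (e + 1) ^ (L + 2) := by
  have := card_le_of_separated (α := Fin n) (e := e) hL (by simpa using hn)
    ((outputList C (e + (L + 1)) Y).image wordSupport)
    (by rwa [card_image_of_injective _ wordSupport_injective])
    (by
      intro c hc d hd hne
      obtain ⟨c, hc', rfl⟩ := mem_image.1 hc
      obtain ⟨d, hd', rfl⟩ := mem_image.1 hd
      rw [← hammingDist_eq_card_symmDiff]
      exact hC.2 c (mem_outputList.1 hc').1 d (mem_outputList.1 hd').1 fun h => hne (by rw [h]))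
    (Y.image wordSupport) (by
      intro y hy c hc
      obtain ⟨y, hy', rfl⟩ := mem_image.1 hy
      obtain ⟨c, hc', rfl⟩ := mem_image.1 hc
      rw [← hammingDist_eq_card_symmDiff]
      exact (mem_outputList.1 hc').2 y hy')
  rwa [card_image_of_injective _ wordSupport_injective, Fintype.card_fin] at this

theorem exists_code_of_family {e t : ℕ} {ι : Type*} [DecidableEq ι] (I : Finset ι)
    (hI : I.Nonempty) (S : ι → Finset (Fin n)) (Y : Finset (Finset (Fin n)))
    (hS : ∀ i ∈ I, ∀ j ∈ I, i ≠ j → 2 * e + 1 ≤ (S i ∆ S j).card)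
    (hY : ∀ y ∈ Y, ∀ i ∈ I, (y ∆ S i).card ≤ t) :
    ∃ C Y' : Finset (BinaryWord n), IsErrorCorrecting e C ∧ Y'.card = Y.card ∧
      I.card ≤ (outputList C t Y').card := by
  have hinj : Set.InjOn (fun i => wordOfSet (S i)) I := by
    intro i hi j hj h
    by_contra hne
    have h1 := hS i hi j hj hne
    rw [wordOfSet_injective h] at h1
    simp at h1
  refine ⟨I.image fun i => wordOfSet (S i), Y.image wordOfSet, ⟨hI.image _, ?_⟩,
    card_image_of_injective _ wordOfSet_injective, ?_⟩
  · intro c hc d hd hne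
    obtain ⟨i, hi, rfl⟩ := mem_image.1 hc
    obtain ⟨j, hj, rfl⟩ := mem_image.1 hd
    rw [hammingDist_wordOfSet]
    exact hS i hi j hj fun h => hne (by rw [h])
  · rw [← card_image_of_injOn hinj]
    refine card_le_card fun c hc => mem_outputList.2 ⟨hc, fun y hy => ?_⟩
    obtain ⟨i, hi, rfl⟩ := mem_image.1 hc
    obtain ⟨y, hy', rfl⟩ := mem_image.1 hy
    rw [hammingDist_wordOfSet]
    exact hY y hy' i hi

end Words

theorem mainTheorem4 (n e l b : ℕ) (hl : 3 ≤ l)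
    (hb : max (3 * (e + l)) (4 * e + 4) ≤ b) (hn : lengthBound e l b ≤ (n : ℤ)) :
    (∀ N : ℕ, ballVolume n (l - 1) + (e + 1) ^ (l + 1) + 1 ≤ N →
      ∀ C : Finset (BinaryWord n), IsErrorCorrecting e C → listSize C (e + l) N ≤ l) ∧
    IsChannelNumber n l e (l + 1) (ballVolume n (l - 1) + (e + 1) ^ (l + 1)) := by
  obtain ⟨L, rfl⟩ : ∃ L, l = L + 1 := ⟨l - 1, by omega⟩
  have hL : 2 ≤ L := by omega
  rw [Nat.add_sub_cancel]
  have hn' := le_of_lengthBound_le ((le_max_right _ _).trans hb) hn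
  have hupper : ∀ C Y : Finset (BinaryWord n), IsErrorCorrecting e C →
      L + 2 ≤ (outputList C (e + (L + 1)) Y).card → Y.card ≤ ballVolume n L + (e + 1) ^ (L + 1 + 1) :=
    fun C Y hC h => card_le_of_lt_card_outputList hL hn' hC h
  have hblocks : (L + 1 + 1) * (e + 1) ≤ n := by
    have h1 : L * L * (7 * (e + 1)) ≤ L * L * lengthFactor e := by
      apply Nat.mul_le_mul_left
      unfold lengthFactor
      nlinarith
    have h2 : (L + 1 + 1) * (e + 1) ≤ L * L * 7 * (e + 1) :=
      Nat.mul_le_mul_right _ (by nlinarith)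
    have h3 : L * L * 7 * (e + 1) = L * L * (7 * (e + 1)) := by ring
    omega
  obtain ⟨φ⟩ : Nonempty (Fin (L + 1 + 1) × Fin (e + 1) ↪ Fin n) := by
    apply Function.Embedding.nonempty_of_card_le
    simpa using hblocks
  obtain ⟨S, Y, v, hS, hYc, hY, hvY, hv⟩ := exists_large_output_families (by omega) φ
  rw [Fintype.card_fin] at hYc
  refine ⟨fun N hN C hC => ?_, ⟨?_, ?_⟩, ?_⟩
  · refine Finset.sup_le fun Y hY => ?_
    by_contra! h
    have h1 := hupper C Y hC h
    have h2 := (Finset.mem_powersetCard.1 hY).2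
    omega
  · obtain ⟨C, Y', hC, hY', hT⟩ := exists_code_of_family (e := e) Finset.univ Finset.univ_nonempty
      S Y (fun i _ j _ hij => hS i j hij) fun y hy i _ => hY y hy i
    refine ⟨C, Y', hC, hY'.trans hYc, ?_⟩
    simpa using hT
  · rintro M ⟨C, Y', hC, rfl, hT⟩
    exact hupper C Y' hC hT
  -- The first `l` blocks with the enlarged output set `insert v Y` exceed the supposed maximum for
  -- every `h' ≤ l`.
  · intro h' hh' hmax
    have hcard : (Finset.univ.erase (Fin.last (L + 1))).card = L + 1 := by
      rw [Finset.card_erase_of_mem (Finset.mem_univ _), Finset.card_univ, Fintype.card_fin]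
      rfl
    obtain ⟨C, Y', hC, hY', hT⟩ := exists_code_of_family (e := e) (t := e + (L + 1))
      (Finset.univ.erase (Fin.last (L + 1))) (Finset.card_pos.1 (by omega)) S (insert v Y)
      (fun i _ j _ hij => hS i j hij) (by
        intro y hy i hi
        rcases Finset.mem_insert.1 hy with rfl | hy
        · exact hv i (Finset.ne_of_mem_erase hi)
        · exact hY y hy i)
    rw [Finset.card_insert_of_notMem hvY, hYc] at hY'
    rw [hcard] at hT
    have := hmax.2 ⟨C, Y', hC, rfl, by omega⟩
    unfold ballVolume at this
    omega
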